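/- Let $M\in\mathbb R^{n\times n}$ be a $P$-matrix (all principal minors are positive), let $b\in\mathbb R^n$, and put $A=[M,\,-I_n]\in\mathbb R^{n\times 2n}$, $$S_1=\{w\in\mathbb R^{2n}: Aw=b\},\qquad S_2=\{w\in\mathbb R^{2n}: w_j\ge 0,\ w_{n+j}\ge 0,\ w_jw_{n+j}=0,\ j=1,\dots,n\}.$$ For a closed set $S$ let $P_S(w)=\{y\in S:\|y-w\|\le\|z-w\|\ \forall z\in S\}$ be the (possibly multivalued) Euclidean projection. For $Q\in\{(AA^{\mathsf T})^{-1}, I_n\}$ let $$f_Q(w)=\tfrac12 w^{\mathsf T}A^{\mathsf T}QAw-w^{\mathsf T}A^{\mathsf T}Qb+\tfrac12 b^{\mathsf T}Qb,$$ let $L_Q=1$ if $Q=(AA^{\mathsf T})^{-1}$ and $L_Q=\|A\|^2$ (Euclidean operator norm) if $Q=I_n$, and let $\delta_{S_2}$ be $0$ on $S_2$ and $+\infty$ elsewhere. Then $S_1\cap S_2$ consists of a single point $w^*$, and the vector $x^*$ of its first $n$ coordinates is the unique solution of the linear complementarity problem $x\ge 0$, $Mx-b\ge 0$, $\langle x,Mx-b\rangle=0$.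 The function $f_Q+\delta_{S_2}$ has global minimum value $0$, attained at $w^*$. Moreover, for either choice of $Q$ and every $\lambda\in(0,1/L_Q]$ there are constants $\kappa,c\in[0,1)$ such that, for every sequence $\{w^k\}_{k\ge0}\subset\mathbb R^{2n}$ with arbitrary $w^0$ and $$w^{k+1}\in T_{\rm PS}^{\lambda}(w^k):=P_{S_2}\bigl(w^k-\lambda\nabla f_Q(w^k)\bigr)\qquad(k\ge 0),$$ the following hold. (i) $w^k\to w^*$ with a local $Q$-linear rate: $\|w^{k+1}-w^*\|\le\kappa\|w^k-w^*\|$ for all sufficiently large $k$. (ii) The objective values $V(w^k)$, $V=f_Q+\delta_{S_2}$, converge to the global optimum $0$ with a local $Q$-linear rate: $V(w^{k+1})\le c\,V(w^k)$ for all sufficiently large $k$. Finally, for $Q=(AA^{\mathsf T})^{-1}$ one has $1/L_Q=1$, and for $\lambda=1$ the iteration is the method of alternating projections: $T_{\rm PS}^{1}=P_{S_2}\circ P_{S_1}$. -/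

import Mathlib

open Filter Topology
open scoped Matrix

noncomputable section

namespace LCPProj

/-- `M` is a P-matrix: all principal minors of `M` are positive. (The minor of the empty index set
is `1`, so it imposes no condition.) -/
def IsPMatrix {n : ℕ} (M : Matrix (Fin n) (Fin n) ℝ) : Prop :=
  ∀ s : Finset (Fin n), 0 < (M.submatrix (fun i : s => i.1) (fun i : s => i.1)).det

/-- `x` solves the linear complementarity problem `x ≥ 0`, `M x - b ≥ 0`, `⟨x, M x - b⟩ = 0`. -/
def IsLCPSolution {n : ℕ} (M : Matrix (Fin n) (Fin n) ℝ) (b x : Fin n → ℝ) : Prop :=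
  (∀ j, 0 ≤ x j) ∧ (∀ j, 0 ≤ (M *ᵥ x - b) j) ∧ x ⬝ᵥ (M *ᵥ x - b) = 0

/-- The Euclidean space `ℝ²ⁿ`. A point is a pair `w = (x, y)`; the coordinate `w_j` is
`w (Sum.inl j)` and the coordinate `w_{n+j}` is `w (Sum.inr j)`. -/
abbrev Space (n : ℕ) : Type := EuclideanSpace ℝ (Fin n ⊕ Fin n)

/-- The `n × 2n` matrix `A = [M, -I]`. -/
def lcpMatrix {n : ℕ} (M : Matrix (Fin n) (Fin n) ℝ) : Matrix (Fin n) (Fin n ⊕ Fin n) ℝ :=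
  Matrix.fromCols M (-1)

/-- The affine set `S₁ = {w | A w = b}`. -/
def affineSet {n : ℕ} (A : Matrix (Fin n) (Fin n ⊕ Fin n) ℝ) (b : Fin n → ℝ) : Set (Space n) :=
  {w | A *ᵥ w.ofLp = b}

/-- The complementarity set
`S₂ = {w | w_j ≥ 0, w_{n+j} ≥ 0, w_j w_{n+j} = 0 for all j}`. -/
def complSet (n : ℕ) : Set (Space n) :=
  {w | ∀ j : Fin n, 0 ≤ w (Sum.inl j) ∧ 0 ≤ w (Sum.inr j) ∧ w (Sum.inl j) * w (Sum.inr j) = 0}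

/-- The (set-valued) metric projection onto `S`: all nearest points of `S` to `w`. -/
def proj {E : Type*} [NormedAddCommGroup E] (S : Set E) (w : E) : Set E :=
  {y | y ∈ S ∧ ∀ z ∈ S, ‖y - w‖ ≤ ‖z - w‖}

/-- `f_Q(w) = ½ wᵀAᵀQAw - wᵀAᵀQb + ½ bᵀQb`. -/
def fQ {n : ℕ} (A : Matrix (Fin n) (Fin n ⊕ Fin n) ℝ) (Q : Matrix (Fin n) (Fin n) ℝ)
    (b : Fin n → ℝ) (w : Space n) : ℝ :=
  (1 / 2) * (w.ofLp ⬝ᵥ ((Aᵀ * Q * A) *ᵥ w.ofLp)) - w.ofLp ⬝ᵥ ((Aᵀ * Q) *ᵥ b)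
    + (1 / 2) * (b ⬝ᵥ (Q *ᵥ b))

open scoped Matrix.Norms.L2Operator Classical in
/-- The constant `L_Q`: it is `1` if `Q = (AAᵀ)⁻¹`, and `‖A‖²` (Euclidean operator norm) if
`Q = I`. -/
def LQ {n : ℕ} (A : Matrix (Fin n) (Fin n ⊕ Fin n) ℝ) (Q : Matrix (Fin n) (Fin n) ℝ) : ℝ :=
  if Q = (A * Aᵀ)⁻¹ then 1 else ‖A‖ ^ 2

/-- The projected subgradient operator `T_PS(w) = P_{S₂}(w - lam ∇f_Q(w))`. -/
def psMap {n : ℕ} (A : Matrix (Fin n) (Fin n ⊕ Fin n) ℝ) (Q : Matrix (Fin n) (Fin n) ℝ)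
    (b : Fin n → ℝ) (lam : ℝ) (w : Space n) : Set (Space n) :=
  proj (complSet n) (w - lam • gradient (fQ A Q b) w)

/-- The operator `P_{S} ∘ P_{R}` of the method of alternating projections. -/
def altProj {E : Type*} [NormedAddCommGroup E] (R S : Set E) (w : E) : Set E :=
  {y | ∃ z ∈ proj R w, y ∈ proj S z}

open scoped Classical in
/-- The objective `f_Q + δ_{S₂}`, which takes the value `+∞` outside `S₂`. -/
def objective {n : ℕ} (A : Matrix (Fin n) (Fin n ⊕ Fin n) ℝ) (Q : Matrix (Fin n) (Fin n) ℝ)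
    (b : Fin n → ℝ) (w : Space n) : EReal :=
  (fQ A Q b w : EReal) + (if w ∈ complSet n then 0 else ⊤)

end LCPProj

end

/-!
The argument rests on the fact that a P-matrix reverses the sign of no nonzero vector:
`x_j (M x)_j ≤ 0` for all `j` forces `x = 0` (`IsPMatrix.eq_zero_of_mul_mulVec_nonpos`). It is
used twice.

Applied to `M`, it shows that `A = [M, -I]` has no nonzero kernel vector `d` with
`d_j d_{n+j} ≤ 0`. Differences of points of `S₂` have this sign pattern, so by compactness the form
`⟪H d, d⟫`, `H = AᵀQA`, is at least `μ ‖d‖²` on such differences, with `μ > 0`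
(`IsPMatrix.exists_le_inner_hessian`). In particular `S₁ ∩ S₂` has at most one point, and `A` maps
`S₂` onto a closed set.

Applied to `Mᵀ`, it shows that a point of `S₂` which is stationary for `f_Q` lies in `S₁`
(`IsPMatrix.eq_zero_of_stationary`): with `u = Q (A w - b)`, stationarity on `S₂` yields
`u_j (Mᵀ u)_j ≤ 0` for all `j`. A minimiser of `‖A w - b‖` over `S₂` is stationary, and hence
`S₁ ∩ S₂` is nonempty (`IsPMatrix.exists_mem_inter`).

Let `w*` be the common point, so that `f_Q(w) = ½ ⟪H (w - w*), w - w*⟫`. For admissible `lam` a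
projected gradient step minimises over `S₂` a quadratic majorant of `f_Q`
(`inner_map_step_le`). The values therefore decrease, the iterates are bounded by the error bound,
and every cluster point minimises its own majorant, is stationary, and equals `w*`
(`tendsto_of_mem_proj_step`). No strict decrease is needed, so the step size `1 / L_Q` is included.

Near `w*` the set `S₂` is star-shaped about `w*` (`eventually_segment_mem_complSet`). When the
segment from `w*` to the new iterate lies in `S₂`, the new iterate is no farther from `w*` than the
point that was projected, whence `κ² = 1 - lam μ` (`norm_sq_step_le`). When the segment from `w*` to
the old iterate lies in `S₂`, the majorant may be evaluated on it, which gives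
`c = 1 / (1 + lam μ)` (`inner_map_step_le_mul`).
-/

/-! ### P-matrices do not reverse the sign of any nonzero vector -/

namespace LCPProj

/-- A scaling of a P-matrix by rows, shifted by a nonnegative diagonal matrix, has positive
determinant: by multilinearity the determinant is `∑ s, (∏ i ∈ s, c i) (∏ i ∉ s, d i) det M_s`,
where all terms are nonnegative and the one with `s = {i | c i ≠ 0}` is positive. -/
theorem IsPMatrix.det_diagonal_mul_add_diagonal_pos {n : ℕ} {M : Matrix (Fin n) (Fin n) ℝ}
    (hM : IsPMatrix M) {c d : Fin n → ℝ} (hc : ∀ i, 0 ≤ c i) (hd : ∀ i, 0 ≤ d i)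
    (hcd : ∀ i, c i = 0 → 0 < d i) :
    0 < (Matrix.diagonal c * M + Matrix.diagonal d).det := by
  have key : (Matrix.diagonal c * M + Matrix.diagonal d).det =
      ∑ s : Finset (Fin n), (∏ i, if i ∈ s then c i else d i) *
        (M.submatrix (fun i : s => i.1) (fun i : s => i.1)).det := by
    have h1 : (Matrix.diagonal c * M + Matrix.diagonal d).det =
        Matrix.detRowAlternating ((fun i => c i • M i) +
          (fun i => d i • (1 : Matrix (Fin n) (Fin n) ℝ) i)) := by
      rw [Matrix.det]
      congr 1
      ext i j
      simp [Matrix.diagonal_mul, Matrix.diagonal_apply, Matrix.one_apply]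
    rw [h1, AlternatingMap.map_add_univ]
    refine Finset.sum_congr rfl fun s _ => ?_
    have h2 : s.piecewise (fun i => c i • M i)
          (fun i => d i • (1 : Matrix (Fin n) (Fin n) ℝ) i) =
        fun i => (if i ∈ s then c i else d i) •
          s.piecewise M.row (1 : Matrix (Fin n) (Fin n) ℝ).row i := by
      funext i
      by_cases h : i ∈ s <;> simp [Finset.piecewise, h, Matrix.row]
    rw [h2, AlternatingMap.map_smul_univ, smul_eq_mul]
    congr 1
    exact Matrix.det_piecewise_one_eq_submatrix_det M s
  rw [key]
  have hprod : ∀ (s : Finset (Fin n)) (i : Fin n), 0 ≤ if i ∈ s then c i else d i := by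
    intro s i
    split_ifs
    exacts [hc i, hd i]
  refine Finset.sum_pos'
    (fun s _ => mul_nonneg (Finset.prod_nonneg fun i _ => hprod s i) (hM s).le)
    ⟨Finset.univ.filter (fun i => c i ≠ 0), Finset.mem_univ _,
      mul_pos (Finset.prod_pos fun i _ => ?_) (hM _)⟩
  by_cases h : c i = 0
  · simpa [h] using hcd i h
  · simpa [h] using lt_of_le_of_ne (hc i) (Ne.symm h)

/-- A P-matrix reverses the sign of no nonzero vector. If `x` is sign-reversed, then
`(diag c * M + diag d) x = 0` with `c i = (x i)²` and `d i = - x i (M x) i` (with `d i = 1` where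
`x i = 0`), which contradicts the positivity of the determinant. -/
theorem IsPMatrix.eq_zero_of_mul_mulVec_nonpos {n : ℕ} {M : Matrix (Fin n) (Fin n) ℝ}
    (hM : IsPMatrix M) {x : Fin n → ℝ} (hx : ∀ i, x i * (M *ᵥ x) i ≤ 0) : x = 0 := by
  by_contra hne
  let c : Fin n → ℝ := fun i => x i ^ 2
  let d : Fin n → ℝ := fun i => if x i = 0 then 1 else -(x i * (M *ᵥ x) i)
  have hpos : 0 < (Matrix.diagonal c * M + Matrix.diagonal d).det := by
    refine hM.det_diagonal_mul_add_diagonal_pos (fun i => sq_nonneg _) (fun i => ?_)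
      (fun i hi => ?_)
    · simp only [d]
      split_ifs
      · exact zero_le_one
      · linarith [hx i]
    · have : x i = 0 := by simpa [c] using hi
      simp [d, this]
  refine hpos.ne' (Matrix.exists_mulVec_eq_zero_iff.mp ⟨x, hne, ?_⟩)
  funext i
  rw [Matrix.add_mulVec, ← Matrix.mulVec_mulVec, Pi.add_apply, Matrix.mulVec_diagonal,
    Matrix.mulVec_diagonal]
  by_cases h : x i = 0
  · simp [c, h]
  · simp only [c, d, h, if_false, Pi.zero_apply]
    ring

theorem IsPMatrix.transpose {n : ℕ} {M : Matrix (Fin n) (Fin n) ℝ} (hM : IsPMatrix M) :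
    IsPMatrix Mᵀ := by
  intro s
  have h := hM s
  rwa [← Matrix.det_transpose, Matrix.transpose_submatrix] at h

end LCPProj

/-! ### Projected gradient steps for a quadratic function on a nonconvex set -/

namespace LCPProj

theorem nonneg_of_forall_small {g C ε : ℝ} (hε : 0 < ε)
    (h : ∀ t, 0 < t → t ≤ ε → 0 ≤ t * g + C * t ^ 2) : 0 ≤ g := by
  by_contra! hg
  have hC : 0 < 2 * (|C| + 1) := by positivity
  set t := min ε (-g / (2 * (|C| + 1))) with ht
  have ht0 : 0 < t := lt_min hε (div_pos (neg_pos.mpr hg) hC)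
  have h1 : t * (2 * (|C| + 1)) ≤ -g := (le_div_iff₀ hC).mp (min_le_right _ _)
  have h2 : 0 ≤ t * (g + C * t) := by linarith [h t ht0 (min_le_left _ _)]
  have h3 : 0 ≤ g + C * t := nonneg_of_mul_nonneg_right h2 ht0
  nlinarith [mul_le_mul_of_nonneg_right (le_abs_self C) ht0.le]

section Quadratic

variable {E : Type*} [NormedAddCommGroup E] [InnerProductSpace ℝ E]

theorem inner_map_sub_expand {H : E →L[ℝ] E} (hH : ∀ x y, inner ℝ (H x) y = inner ℝ x (H y))
    (a w y : E) :
    inner ℝ (H (y - a)) (y - a) = inner ℝ (H (w - a)) (w - a)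
      + 2 * inner ℝ (H (w - a)) (y - w) + inner ℝ (H (y - w)) (y - w) := by
  have h : y - a = (w - a) + (y - w) := by abel
  rw [h, map_add, inner_add_left, inner_add_right, inner_add_right, hH (y - w) (w - a),
    real_inner_comm (H (w - a)) (y - w)]
  ring

theorem inner_map_nonneg {H : E →L[ℝ] E} {lam : ℝ} (hlam : 0 ≤ lam)
    (hHlam : ∀ x, lam * ‖H x‖ ^ 2 ≤ inner ℝ (H x) x) (x : E) : 0 ≤ inner ℝ (H x) x :=
  le_trans (by positivity) (hHlam x)

theorem inner_map_le {H : E →L[ℝ] E} {lam : ℝ} (hlam : 0 ≤ lam)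
    (hHlam : ∀ x, lam * ‖H x‖ ^ 2 ≤ inner ℝ (H x) x) (x : E) :
    lam * inner ℝ (H x) x ≤ ‖x‖ ^ 2 := by
  have h1 := hHlam x
  have h2 := real_inner_le_norm (H x) x
  have h3 : lam * ‖H x‖ ≤ ‖x‖ := by
    rcases (norm_nonneg (H x)).eq_or_lt with h | h
    · rw [← h, mul_zero]; exact norm_nonneg x
    · nlinarith
  calc lam * inner ℝ (H x) x ≤ lam * (‖H x‖ * ‖x‖) := mul_le_mul_of_nonneg_left h2 hlam
    _ = (lam * ‖H x‖) * ‖x‖ := by ring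
    _ ≤ ‖x‖ * ‖x‖ := mul_le_mul_of_nonneg_right h3 (norm_nonneg x)
    _ = ‖x‖ ^ 2 := by ring

theorem proj_inner_le {S : Set E} {w g y z : E} {lam : ℝ}
    (hy : y ∈ proj S (w - lam • g)) (hz : z ∈ S) :
    2 * lam * inner ℝ g (y - w) + ‖y - w‖ ^ 2 ≤ 2 * lam * inner ℝ g (z - w) + ‖z - w‖ ^ 2 := by
  have h := pow_le_pow_left₀ (norm_nonneg _) (hy.2 z hz) 2
  have e : ∀ x : E, ‖x - (w - lam • g)‖ ^ 2 =
      ‖x - w‖ ^ 2 + 2 * lam * inner ℝ g (x - w) + lam ^ 2 * ‖g‖ ^ 2 := by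
    intro x
    have : x - (w - lam • g) = (x - w) + lam • g := by abel
    rw [this, norm_add_sq_real, inner_smul_right, real_inner_comm, norm_smul, mul_pow,
      Real.norm_eq_abs, sq_abs]
    ring
  rw [e, e] at h
  linarith

/-- One projected gradient step minimises over `S` a quadratic majorant of
`w ↦ ⟪H (w - a), w - a⟫`. -/
theorem inner_map_step_le {H : E →L[ℝ] E} (hH : ∀ x y, inner ℝ (H x) y = inner ℝ x (H y))
    {lam : ℝ} (hlam : 0 < lam) (hHlam : ∀ x, lam * ‖H x‖ ^ 2 ≤ inner ℝ (H x) x)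
    {S : Set E} {a w y z : E} (hy : y ∈ proj S (w - lam • H (w - a))) (hz : z ∈ S) :
    inner ℝ (H (y - a)) (y - a) ≤ inner ℝ (H (w - a)) (w - a)
      + 2 * inner ℝ (H (w - a)) (z - w) + (1 / lam) * ‖z - w‖ ^ 2 := by
  have h1 := proj_inner_le hy hz
  have h2 := inner_map_le hlam.le hHlam (y - w)
  rw [inner_map_sub_expand hH a w y]
  refine le_of_mul_le_mul_left ?_ hlam
  have h3 : lam * ((1 / lam) * ‖z - w‖ ^ 2) = ‖z - w‖ ^ 2 := by field_simp
  linarith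

/-- The local contraction estimate: if the segment from `a` to the new iterate `y` lies in `S`,
then `y` is at most as far from `a` as the point that was projected. -/
theorem norm_sq_step_le {H : E →L[ℝ] E} {lam μ : ℝ} (hlam : 0 < lam)
    (hHlam : ∀ x, lam * ‖H x‖ ^ 2 ≤ inner ℝ (H x) x) {S : Set E} {a w y : E}
    (hμ : μ * ‖w - a‖ ^ 2 ≤ inner ℝ (H (w - a)) (w - a))
    (hy : y ∈ proj S (w - lam • H (w - a)))
    (hseg : ∀ t : ℝ, 0 ≤ t → t ≤ 1 → a + t • (y - a) ∈ S) :
    ‖y - a‖ ^ 2 ≤ (1 - lam * μ) * ‖w - a‖ ^ 2 := by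
  set p := w - lam • H (w - a) with hp
  have h1 : 0 ≤ -2 * inner ℝ (y - p) (y - a) := by
    refine nonneg_of_forall_small (C := ‖y - a‖ ^ 2) zero_lt_one fun s hs0 hs1 => ?_
    have h := pow_le_pow_left₀ (norm_nonneg _)
      (hy.2 _ (hseg (1 - s) (by linarith) (by linarith))) 2
    have e : a + (1 - s) • (y - a) - p = (y - p) - s • (y - a) := by
      rw [sub_smul, one_smul]; abel
    rw [e, norm_sub_sq_real (y - p), inner_smul_right, norm_smul, mul_pow, Real.norm_eq_abs,
      sq_abs] at h
    linarith
  have h2 : ‖y - a‖ ^ 2 ≤ ‖p - a‖ * ‖y - a‖ := by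
    have e : inner ℝ (y - a) (y - a) = inner ℝ (y - p) (y - a) + inner ℝ (p - a) (y - a) := by
      rw [← inner_add_left]; congr 1; abel
    rw [← real_inner_self_eq_norm_sq, e]
    linarith [real_inner_le_norm (p - a) (y - a)]
  have h3 : ‖y - a‖ ≤ ‖p - a‖ := by
    rcases (norm_nonneg (y - a)).eq_or_lt with h | h
    · rw [← h]; exact norm_nonneg _
    · nlinarith
  have h4 : ‖p - a‖ ^ 2 = ‖w - a‖ ^ 2 - 2 * lam * inner ℝ (H (w - a)) (w - a)
      + lam ^ 2 * ‖H (w - a)‖ ^ 2 := by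
    have e : p - a = (w - a) - lam • H (w - a) := by rw [hp]; abel
    rw [e, norm_sub_sq_real, inner_smul_right, norm_smul, mul_pow, Real.norm_eq_abs, sq_abs,
      real_inner_comm]
    ring
  have h5 := pow_le_pow_left₀ (norm_nonneg _) h3 2
  have h6 := mul_le_mul_of_nonneg_left (hHlam (w - a)) hlam.le
  have h7 := mul_le_mul_of_nonneg_left hμ hlam.le
  nlinarith

/-- The local decrease of the objective: the majorant is evaluated at the point that divides the
segment from `w` to `a` in the ratio `lam * μ : 1`. -/
theorem inner_map_step_le_mul {H : E →L[ℝ] E} (hH : ∀ x y, inner ℝ (H x) y = inner ℝ x (H y))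
    {lam μ : ℝ} (hlam : 0 < lam) (hμ0 : 0 < μ)
    (hHlam : ∀ x, lam * ‖H x‖ ^ 2 ≤ inner ℝ (H x) x) {S : Set E} {a w y : E}
    (hμ : μ * ‖w - a‖ ^ 2 ≤ inner ℝ (H (w - a)) (w - a))
    (hy : y ∈ proj S (w - lam • H (w - a)))
    (hseg : ∀ t : ℝ, 0 ≤ t → t ≤ 1 → a + t • (w - a) ∈ S) :
    inner ℝ (H (y - a)) (y - a) ≤ (1 / (1 + lam * μ)) * inner ℝ (H (w - a)) (w - a) := by
  have hm : 0 < lam * μ := mul_pos hlam hμ0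
  set m := lam * μ with hm_def
  have h := inner_map_step_le hH hlam hHlam hy
    (hseg (1 / (1 + m)) (by positivity) ((div_le_one (by positivity)).mpr (by linarith)))
  set s := m / (1 + m) with hs
  have e : a + (1 / (1 + m)) • (w - a) - w = -(s • (w - a)) := by
    have : 1 / (1 + m) = 1 - s := by rw [hs]; field_simp; ring
    rw [this, sub_smul, one_smul]; abel
  rw [e, inner_neg_right, inner_smul_right, norm_neg, norm_smul, mul_pow, Real.norm_eq_abs,
    sq_abs] at h
  set q := inner ℝ (H (w - a)) (w - a) with hq
  have h1 : (1 / lam) * (s ^ 2 * ‖w - a‖ ^ 2) ≤ s ^ 2 / m * q := by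
    have : (1 / lam) * (s ^ 2 * ‖w - a‖ ^ 2) = s ^ 2 / m * (μ * ‖w - a‖ ^ 2) := by
      rw [hm_def]; field_simp
    rw [this]
    exact mul_le_mul_of_nonneg_left hμ (by positivity)
  have hq0 : 0 ≤ q := inner_map_nonneg hlam.le hHlam _
  have h2 : q + 2 * -(s * q) + s ^ 2 / m * q = (1 / (1 + m)) * q - s ^ 2 * q := by
    rw [hs]; field_simp; ring
  have h3 : 0 ≤ s ^ 2 * q := by positivity
  linarith

/-- Global convergence of the projected gradient method. The values of the quadratic function
decrease along the iteration, so the iterates stay in a compact set, and by the majorant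
inequality every cluster point satisfies the stationarity condition in `hfix`. -/
theorem tendsto_of_mem_proj_step [ProperSpace E] {H : E →L[ℝ] E}
    (hH : ∀ x y, inner ℝ (H x) y = inner ℝ x (H y)) {lam μ : ℝ} (hlam : 0 < lam) (hμ0 : 0 < μ)
    (hHlam : ∀ x, lam * ‖H x‖ ^ 2 ≤ inner ℝ (H x) x) {S : Set E} (hS : IsClosed S) {a : E}
    (hμ : ∀ w ∈ S, μ * ‖w - a‖ ^ 2 ≤ inner ℝ (H (w - a)) (w - a))
    (hfix : ∀ w ∈ S, (∀ z ∈ S,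
      0 ≤ 2 * inner ℝ (H (w - a)) (z - w) + (1 / lam) * ‖z - w‖ ^ 2) → w = a)
    {w : ℕ → E} (hw : ∀ k, w (k + 1) ∈ proj S (w k - lam • H (w k - a))) :
    Tendsto w atTop (𝓝 a) := by
  let q : E → ℝ := fun x => inner ℝ (H (x - a)) (x - a)
  have hqc : Continuous q := by fun_prop
  have hq0 : ∀ x, 0 ≤ q x := fun x => inner_map_nonneg hlam.le hHlam _
  have hwS : ∀ k, w (k + 1) ∈ S := fun k => (hw k).1
  have hanti : Antitone fun k => q (w (k + 1)) := by
    refine antitone_nat_of_succ_le fun k => ?_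
    have h := inner_map_step_le hH hlam hHlam (hw (k + 1)) (hwS k)
    simp only [sub_self, inner_zero_right, norm_zero] at h
    simp only [q]
    linarith
  have hlim : Tendsto (fun k => q (w (k + 1))) atTop (𝓝 (⨅ k, q (w (k + 1)))) :=
    tendsto_atTop_ciInf hanti ⟨0, by rintro _ ⟨k, rfl⟩; exact hq0 _⟩
  set v := ⨅ k, q (w (k + 1))
  rw [← tendsto_add_atTop_iff_nat 1]
  have hK : IsCompact (S ∩ Metric.closedBall a (Real.sqrt (q (w 1) / μ))) :=
    (isCompact_closedBall _ _).inter_left hS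
  refine hK.tendsto_nhds_of_unique_mapClusterPt (Eventually.of_forall fun k => ⟨hwS k, ?_⟩) ?_
  · rw [mem_closedBall_iff_norm]
    refine Real.le_sqrt_of_sq_le ((le_div_iff₀ hμ0).mpr ?_)
    have h1 := hμ _ (hwS k)
    have h2 : q (w (k + 1)) ≤ q (w (0 + 1)) := hanti (Nat.zero_le k)
    simp only [q, zero_add] at h2 ⊢
    linarith
  · rintro x ⟨hxS, -⟩ hx
    obtain ⟨φ, hφ, hφx⟩ := hx.tendsto_subseq
    have hqx : q x = v :=
      tendsto_nhds_unique ((hqc.tendsto x).comp hφx) (hlim.comp hφ.tendsto_atTop)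
    refine hfix x hxS fun z hz => ?_
    have hle : v ≤ q x + 2 * inner ℝ (H (x - a)) (z - x) + (1 / lam) * ‖z - x‖ ^ 2 := by
      have hc : Continuous fun x : E =>
          q x + 2 * inner ℝ (H (x - a)) (z - x) + (1 / lam) * ‖z - x‖ ^ 2 := by fun_prop
      refine ge_of_tendsto' ((hc.tendsto x).comp hφx) fun k => ?_
      have h1 : v ≤ q (w (φ k + 1 + 1)) :=
        ciInf_le ⟨0, by rintro _ ⟨k, rfl⟩; exact hq0 _⟩ (φ k + 1)
      exact h1.trans (inner_map_step_le hH hlam hHlam (hw (φ k + 1)) hz)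
    linarith

end Quadratic

end LCPProj

/-! ### The complementarity set -/

namespace LCPProj

theorem isClosed_complSet (n : ℕ) : IsClosed (complSet n) := by
  have h : complSet n = ⋂ j : Fin n, {w : Space n | 0 ≤ w (Sum.inl j)} ∩
      ({w : Space n | 0 ≤ w (Sum.inr j)} ∩ {w : Space n | w (Sum.inl j) * w (Sum.inr j) = 0}) := by
    ext w
    simp [complSet]
  rw [h]
  refine isClosed_iInter fun j => ?_
  exact (isClosed_le continuous_const (by fun_prop)).inter
    ((isClosed_le continuous_const (by fun_prop)).inter
      (isClosed_eq (by fun_prop) continuous_const))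

theorem zero_mem_complSet (n : ℕ) : (0 : Space n) ∈ complSet n := fun j => by simp

theorem complSet_sub_mul_nonpos {n : ℕ} {w z : Space n} (hw : w ∈ complSet n)
    (hz : z ∈ complSet n) (j : Fin n) : (w - z) (Sum.inl j) * (w - z) (Sum.inr j) ≤ 0 := by
  obtain ⟨h1, h2, h3⟩ := hw j
  obtain ⟨h4, h5, h6⟩ := hz j
  simp only [PiLp.sub_apply]
  nlinarith [mul_nonneg h1 h5, mul_nonneg h4 h2]

theorem add_single_inl_mem_complSet {n : ℕ} {w : Space n} (hw : w ∈ complSet n) {j : Fin n}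
    (hj : w (Sum.inr j) = 0) {t : ℝ} (ht : 0 ≤ w (Sum.inl j) + t) :
    w + EuclideanSpace.single (Sum.inl j) t ∈ complSet n := by
  intro k
  obtain rfl | hk := eq_or_ne k j
  · simp [hj, ht]
  · simpa [hk] using hw k

theorem add_single_inr_mem_complSet {n : ℕ} {w : Space n} (hw : w ∈ complSet n) {j : Fin n}
    (hj : w (Sum.inl j) = 0) {t : ℝ} (ht : 0 ≤ w (Sum.inr j) + t) :
    w + EuclideanSpace.single (Sum.inr j) t ∈ complSet n := by
  intro k
  obtain rfl | hk := eq_or_ne k j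
  · simp [hj, ht]
  · simpa [hk] using hw k

/-- Near any of its points the complementarity set is star-shaped about that point: the points of
the set near `a` lie on branches through `a`. -/
theorem eventually_segment_mem_complSet {n : ℕ} {a : Space n} (ha : a ∈ complSet n) :
    ∀ᶠ w in 𝓝 a, w ∈ complSet n → ∀ t : ℝ, 0 ≤ t → t ≤ 1 → a + t • (w - a) ∈ complSet n := by
  have hne : ∀ᶠ w : Space n in 𝓝 a, ∀ i, a i ≠ 0 → w i ≠ 0 := by
    refine eventually_all.mpr fun i => ?_
    by_cases h : a i = 0
    · exact Eventually.of_forall fun _ h' => absurd h h'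
    · have hc : Continuous fun w : Space n => w i := by fun_prop
      exact (hc.continuousAt.eventually_ne h).mono fun _ h' _ => h'
  filter_upwards [hne] with w hwa hw t ht0 ht1 j
  obtain ⟨h1, h2, h3⟩ := hw j
  obtain ⟨h4, h5, h6⟩ := ha j
  have e : ∀ i, (a + t • (w - a)) i = (1 - t) * a i + t * w i := by
    intro i
    simp only [PiLp.add_apply, PiLp.smul_apply, PiLp.sub_apply, smul_eq_mul]
    ring
  have ht : 0 ≤ 1 - t := by linarith
  rw [e, e]
  refine ⟨by positivity, by positivity, ?_⟩
  rcases mul_eq_zero.mp h3 with h | h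
  · have : a (Sum.inl j) = 0 := by_contra fun h' => hwa _ h' h
    simp [h, this]
  · have : a (Sum.inr j) = 0 := by_contra fun h' => hwa _ h' h
    simp [h, this]

/-- First-order conditions on the complementarity set: a stationary vector `g` at `w` satisfies
`g_j g_{n+j} ≥ 0`, because it vanishes in the positive coordinate of the pair, and is nonnegative
in both coordinates if the pair is `(0, 0)`. -/
theorem mul_nonneg_of_stationary {n : ℕ} {w g : Space n} (hw : w ∈ complSet n) {C : ℝ}
    (h : ∀ z ∈ complSet n, 0 ≤ 2 * inner ℝ g (z - w) + C * ‖z - w‖ ^ 2) (j : Fin n) :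
    0 ≤ g (Sum.inl j) * g (Sum.inr j) := by
  have hsingle : ∀ (i : Fin n ⊕ Fin n) (t : ℝ), w + EuclideanSpace.single i t ∈ complSet n →
      0 ≤ 2 * (t * g i) + C * t ^ 2 := by
    intro i t hi
    have h1 := h _ hi
    rw [add_sub_cancel_left, EuclideanSpace.inner_single_right, PiLp.norm_single,
      Real.norm_eq_abs, sq_abs] at h1
    simpa using h1
  -- moving a coordinate up is possible when its partner vanishes
  have hup : ∀ i : Fin n ⊕ Fin n,
      (∀ t, 0 ≤ t → w + EuclideanSpace.single i t ∈ complSet n) → 0 ≤ g i := by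
    intro i hi
    have h1 : 0 ≤ 2 * g i := by
      refine nonneg_of_forall_small (C := C) zero_lt_one fun t ht0 _ => ?_
      linarith [hsingle i t (hi t ht0.le)]
    linarith
  -- moving a coordinate down is possible when it is positive
  have hdown : ∀ i : Fin n ⊕ Fin n, 0 < w i →
      (∀ t, 0 ≤ w i + t → w + EuclideanSpace.single i t ∈ complSet n) → g i = 0 := by
    intro i hpos hi
    have h1 : 0 ≤ -(2 * g i) := by
      refine nonneg_of_forall_small (C := C) hpos fun t ht0 ht1 => ?_
      linarith [hsingle i (-t) (hi _ (by linarith))]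
    linarith [hup i fun t ht => hi t (by linarith)]
  obtain ⟨h1, h2, h3⟩ := hw j
  rcases h1.eq_or_lt with h4 | h4
  · rcases h2.eq_or_lt with h5 | h5
    · exact mul_nonneg
        (hup _ fun t ht => add_single_inl_mem_complSet hw h5.symm (by linarith))
        (hup _ fun t ht => add_single_inr_mem_complSet hw h4.symm (by linarith))
    · rw [hdown _ h5 fun t ht => add_single_inr_mem_complSet hw h4.symm ht, mul_zero]
  · have h5 : w (Sum.inr j) = 0 := (mul_eq_zero.mp h3).resolve_left h4.ne'
    rw [hdown _ h4 fun t ht => add_single_inl_mem_complSet hw h5 ht, zero_mul]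

/-! ### The matrix `[M, -I]` -/

theorem lcpMatrix_mulVec_apply {n : ℕ} (M : Matrix (Fin n) (Fin n) ℝ) (w : Fin n ⊕ Fin n → ℝ)
    (j : Fin n) :
    (lcpMatrix M *ᵥ w) j = (M *ᵥ fun k => w (Sum.inl k)) j - w (Sum.inr j) := by
  rw [lcpMatrix, Matrix.fromCols_mulVec, Pi.add_apply, Matrix.neg_mulVec, Matrix.one_mulVec]
  simp [Function.comp_def, sub_eq_add_neg]

theorem lcpMatrix_transpose_mulVec_inl {n : ℕ} (M : Matrix (Fin n) (Fin n) ℝ) (u : Fin n → ℝ)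
    (j : Fin n) : ((lcpMatrix M)ᵀ *ᵥ u) (Sum.inl j) = (Mᵀ *ᵥ u) j := by
  simp [lcpMatrix, Matrix.transpose_fromCols, Matrix.fromRows_mulVec]

theorem lcpMatrix_transpose_mulVec_inr {n : ℕ} (M : Matrix (Fin n) (Fin n) ℝ) (u : Fin n → ℝ)
    (j : Fin n) : ((lcpMatrix M)ᵀ *ᵥ u) (Sum.inr j) = -u j := by
  simp [lcpMatrix, Matrix.transpose_fromCols, Matrix.fromRows_mulVec, Matrix.neg_mulVec]

theorem posDef_lcpMatrix_mul_transpose {n : ℕ} (M : Matrix (Fin n) (Fin n) ℝ) :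
    (lcpMatrix M * (lcpMatrix M)ᵀ).PosDef := by
  rw [← Matrix.conjTranspose_eq_transpose_of_trivial]
  refine Matrix.PosDef.mul_conjTranspose_self _ fun u v huv => ?_
  funext j
  have h := congrFun huv (Sum.inr j)
  simp only at h
  rw [← Matrix.mulVec_transpose, ← Matrix.mulVec_transpose, lcpMatrix_transpose_mulVec_inr,
    lcpMatrix_transpose_mulVec_inr] at h
  linarith

/-- Stationarity of `w ∈ S₂` for a gradient of the form `Aᵀ u` forces `u = 0`: the first-order
conditions say that `u` is sign-reversed by the P-matrix `Mᵀ`. -/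
theorem IsPMatrix.eq_zero_of_stationary {n : ℕ} {M : Matrix (Fin n) (Fin n) ℝ}
    (hM : IsPMatrix M) {u : Fin n → ℝ} {w g : Space n} (hg : g.ofLp = (lcpMatrix M)ᵀ *ᵥ u)
    (hw : w ∈ complSet n) {C : ℝ}
    (h : ∀ z ∈ complSet n, 0 ≤ 2 * inner ℝ g (z - w) + C * ‖z - w‖ ^ 2) : u = 0 := by
  refine hM.transpose.eq_zero_of_mul_mulVec_nonpos fun j => ?_
  have h1 := mul_nonneg_of_stationary hw h j
  rw [hg, lcpMatrix_transpose_mulVec_inl, lcpMatrix_transpose_mulVec_inr] at h1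
  linarith

theorem IsPMatrix.eq_zero_of_lcpMatrix_mulVec_eq_zero {n : ℕ} {M : Matrix (Fin n) (Fin n) ℝ}
    (hM : IsPMatrix M) {d : Space n} (hd : ∀ j, d (Sum.inl j) * d (Sum.inr j) ≤ 0)
    (h : lcpMatrix M *ᵥ d.ofLp = 0) : d = 0 := by
  have h1 : ∀ j, (M *ᵥ fun k => d (Sum.inl k)) j = d (Sum.inr j) := by
    intro j
    have := congrFun h j
    rw [lcpMatrix_mulVec_apply, Pi.zero_apply] at this
    linarith
  have h2 : (fun k => d (Sum.inl k)) = 0 :=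
    hM.eq_zero_of_mul_mulVec_nonpos fun j => by rw [h1]; exact hd j
  ext i
  rcases i with j | j
  · exact congrFun h2 j
  · rw [← h1, h2]; simp

/-! ### The quadratic function `f_Q` -/

/-- The Hessian `AᵀQA` of `f_Q`, as an operator on Euclidean space. -/
noncomputable def hessian {n : ℕ} (A : Matrix (Fin n) (Fin n ⊕ Fin n) ℝ) (Q : Matrix (Fin n) (Fin n) ℝ) :
    Space n →L[ℝ] Space n :=
  Matrix.toEuclideanCLM (𝕜 := ℝ) (Aᵀ * Q * A)

theorem ofLp_hessian {n : ℕ} (A : Matrix (Fin n) (Fin n ⊕ Fin n) ℝ)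
    (Q : Matrix (Fin n) (Fin n) ℝ) (x : Space n) :
    (hessian A Q x).ofLp = Aᵀ *ᵥ (Q *ᵥ (A *ᵥ x.ofLp)) := by
  rw [hessian, Matrix.ofLp_toEuclideanCLM, Matrix.mulVec_mulVec, Matrix.mulVec_mulVec,
    Matrix.mul_assoc]

theorem inner_eq_dotProduct {n : ℕ} (x y : Space n) : inner ℝ x y = x.ofLp ⬝ᵥ y.ofLp := by
  rw [EuclideanSpace.inner_eq_star_dotProduct, dotProduct_comm]
  simp

theorem inner_hessian {n : ℕ} (A : Matrix (Fin n) (Fin n ⊕ Fin n) ℝ)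
    (Q : Matrix (Fin n) (Fin n) ℝ) (x y : Space n) :
    inner ℝ (hessian A Q x) y = (Q *ᵥ (A *ᵥ x.ofLp)) ⬝ᵥ (A *ᵥ y.ofLp) := by
  rw [inner_eq_dotProduct, ofLp_hessian, Matrix.mulVec_transpose, Matrix.dotProduct_mulVec]

theorem mulVec_dotProduct_comm {n : ℕ} {Q : Matrix (Fin n) (Fin n) ℝ} (hQ : Q.PosDef)
    (u v : Fin n → ℝ) : (Q *ᵥ u) ⬝ᵥ v = u ⬝ᵥ (Q *ᵥ v) := by
  have h : Qᵀ = Q := by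
    rw [← Matrix.conjTranspose_eq_transpose_of_trivial]; exact hQ.isHermitian
  rw [Matrix.dotProduct_mulVec, ← Matrix.mulVec_transpose, h]

theorem inner_hessian_comm {n : ℕ} (A : Matrix (Fin n) (Fin n ⊕ Fin n) ℝ)
    {Q : Matrix (Fin n) (Fin n) ℝ} (hQ : Q.PosDef) (x y : Space n) :
    inner ℝ (hessian A Q x) y = inner ℝ x (hessian A Q y) := by
  rw [inner_hessian, mulVec_dotProduct_comm hQ, real_inner_comm, inner_hessian, dotProduct_comm]

theorem fQ_eq_inner_hessian {n : ℕ} {A : Matrix (Fin n) (Fin n ⊕ Fin n) ℝ}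
    {Q : Matrix (Fin n) (Fin n) ℝ} (hQ : Q.PosDef) {b : Fin n → ℝ} {a : Space n}
    (ha : A *ᵥ a.ofLp = b) (w : Space n) :
    fQ A Q b w = (1 / 2) * inner ℝ (hessian A Q (w - a)) (w - a) := by
  have h1 : ∀ v : Fin n → ℝ, w.ofLp ⬝ᵥ (Aᵀ *ᵥ v) = (A *ᵥ w.ofLp) ⬝ᵥ v := by
    intro v
    rw [Matrix.dotProduct_mulVec, Matrix.vecMul_transpose]
  have h2 : (Q *ᵥ (A *ᵥ a.ofLp)) ⬝ᵥ (A *ᵥ w.ofLp) = (A *ᵥ w.ofLp) ⬝ᵥ (Q *ᵥ (A *ᵥ a.ofLp)) :=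
    dotProduct_comm _ _
  have h3 := mulVec_dotProduct_comm hQ (A *ᵥ w.ofLp) (A *ᵥ w.ofLp)
  have h4 := mulVec_dotProduct_comm hQ (A *ᵥ w.ofLp) (A *ᵥ a.ofLp)
  have h5 := mulVec_dotProduct_comm hQ (A *ᵥ a.ofLp) (A *ᵥ a.ofLp)
  rw [inner_hessian, fQ, ← ha, Matrix.mul_assoc, ← Matrix.mulVec_mulVec, ← Matrix.mulVec_mulVec,
    ← Matrix.mulVec_mulVec, h1, h1, WithLp.ofLp_sub, Matrix.mulVec_sub, Matrix.mulVec_sub,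
    sub_dotProduct, dotProduct_sub, dotProduct_sub, h2, h3, h4, h5]
  ring

theorem gradient_fQ {n : ℕ} {A : Matrix (Fin n) (Fin n ⊕ Fin n) ℝ}
    {Q : Matrix (Fin n) (Fin n) ℝ} (hQ : Q.PosDef) {b : Fin n → ℝ} {a : Space n}
    (ha : A *ᵥ a.ofLp = b) (w : Space n) :
    gradient (fQ A Q b) w = hessian A Q (w - a) := by
  have hf : fQ A Q b = fun w => (1 / 2) * inner ℝ (hessian A Q (w - a)) (w - a) :=
    funext (fQ_eq_inner_hessian hQ ha)
  refine HasGradientAt.gradient ?_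
  rw [hasGradientAt_iff_hasFDerivAt, hf]
  have h1 : HasFDerivAt (fun w : Space n => w - a) (ContinuousLinearMap.id ℝ (Space n)) w :=
    (hasFDerivAt_id w).sub_const a
  have h2 := (((hessian A Q).hasFDerivAt.comp w h1).inner ℝ h1).const_mul (1 / 2 : ℝ)
  refine h2.congr_fderiv ?_
  ext v
  have h3 : inner ℝ (hessian A Q v) (w - a) = inner ℝ (hessian A Q (w - a)) v := by
    rw [inner_hessian_comm A hQ, real_inner_comm]
  simp [fderivInnerCLM_apply, InnerProductSpace.toDual_apply_apply, -map_sub, h3]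
  ring

theorem eq_zero_of_posDef_mulVec_eq_zero {n : ℕ} {Q : Matrix (Fin n) (Fin n) ℝ} (hQ : Q.PosDef)
    {u : Fin n → ℝ} (h : Q *ᵥ u = 0) : u = 0 := by
  by_contra hne
  have := hQ.dotProduct_mulVec_pos hne
  rw [h, dotProduct_zero] at this
  exact lt_irrefl _ this

/-- The error bound behind all rates. The vectors `d` with `d_j d_{n+j} ≤ 0` form a closed cone
that contains the differences of points of `S₂`; the form `dᵀAᵀQAd` is positive on the nonzero
vectors of this cone, hence bounded below on its unit sphere. -/
theorem IsPMatrix.exists_le_inner_hessian {n : ℕ} {M : Matrix (Fin n) (Fin n) ℝ}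
    (hM : IsPMatrix M) {Q : Matrix (Fin n) (Fin n) ℝ} (hQ : Q.PosDef) :
    ∃ μ : ℝ, 0 < μ ∧ ∀ w ∈ complSet n, ∀ z ∈ complSet n,
      μ * ‖w - z‖ ^ 2 ≤ inner ℝ (hessian (lcpMatrix M) Q (w - z)) (w - z) := by
  let q : Space n → ℝ := fun d => inner ℝ (hessian (lcpMatrix M) Q d) d
  let K : Set (Space n) := {d | ∀ j, d (Sum.inl j) * d (Sum.inr j) ≤ 0}
  have hK : IsClosed K := by
    have h : K = ⋂ j : Fin n, {d : Space n | d (Sum.inl j) * d (Sum.inr j) ≤ 0} := by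
      ext d
      simp [K]
    rw [h]
    exact isClosed_iInter fun j => isClosed_le (by fun_prop) continuous_const
  have hqc : Continuous q := by fun_prop
  have hqpos : ∀ d ∈ K, d ≠ 0 → 0 < q d := by
    intro d hd hne
    have h1 : lcpMatrix M *ᵥ d.ofLp ≠ 0 := fun h =>
      hne (hM.eq_zero_of_lcpMatrix_mulVec_eq_zero hd h)
    have h2 := hQ.dotProduct_mulVec_pos h1
    simp only [q]
    rw [inner_hessian, mulVec_dotProduct_comm hQ]
    simpa using h2
  have hbound : ∃ μ : ℝ, 0 < μ ∧ ∀ d ∈ K ∩ Metric.sphere 0 1, μ ≤ q d := by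
    rcases (K ∩ Metric.sphere (0 : Space n) 1).eq_empty_or_nonempty with h | h
    · exact ⟨1, one_pos, by simp [h]⟩
    · obtain ⟨d, hd, hmin⟩ := ((isCompact_sphere (0 : Space n) 1).inter_left hK).exists_isMinOn h
        hqc.continuousOn
      refine ⟨q d, hqpos d hd.1 ?_, fun e he => hmin he⟩
      rintro rfl
      simpa using hd.2
  obtain ⟨μ, hμ, hle⟩ := hbound
  refine ⟨μ, hμ, fun w hw z hz => ?_⟩
  have hd := complSet_sub_mul_nonpos hw hz
  set d := w - z
  by_cases hne : d = 0
  · simp [hne]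
  have hn : 0 < ‖d‖ := norm_pos_iff.mpr hne
  have h1 := hle (‖d‖⁻¹ • d) ⟨fun j => by
    have := mul_nonneg (sq_nonneg ‖d‖⁻¹) (neg_nonneg.mpr (hd j))
    simp only [PiLp.smul_apply, smul_eq_mul]
    linarith, by simp [norm_smul, hn.ne']⟩
  simp only [q, map_smul, inner_smul_left, inner_smul_right] at h1
  have h2 := mul_le_mul_of_nonneg_right h1 (sq_nonneg ‖d‖)
  refine h2.trans_eq ?_
  simp only [conj_trivial]
  field_simp

/-! ### Solvability -/

theorem isClosed_image_complSet {n : ℕ} {M : Matrix (Fin n) (Fin n) ℝ} (hM : IsPMatrix M) :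
    IsClosed (Matrix.toEuclideanLin (lcpMatrix M) '' complSet n) := by
  obtain ⟨μ, hμ, hle⟩ := hM.exists_le_inner_hessian Matrix.PosDef.one
  let T : Space n →L[ℝ] EuclideanSpace ℝ (Fin n) :=
    (Matrix.toEuclideanLin (lcpMatrix M)).toContinuousLinearMap
  let F : complSet n → EuclideanSpace ℝ (Fin n) := fun w => T w.1
  have hF : AntilipschitzWith (Real.toNNReal (Real.sqrt (1 / μ))) F := by
    refine AntilipschitzWith.of_le_mul_dist fun w z => ?_
    rw [Real.coe_toNNReal _ (Real.sqrt_nonneg _), Subtype.dist_eq, dist_eq_norm, dist_eq_norm]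
    have h1 := hle w.1 w.2 z.1 z.2
    have h2 : inner ℝ (hessian (lcpMatrix M) 1 (w.1 - z.1)) (w.1 - z.1) = ‖F w - F z‖ ^ 2 := by
      rw [inner_hessian, Matrix.one_mulVec, EuclideanSpace.real_norm_sq_eq]
      simp only [F, ← map_sub]
      simp [dotProduct, sq, T, Matrix.mulVec_sub]
    rw [h2] at h1
    refine le_of_sq_le_sq ?_ (by positivity)
    rw [mul_pow, Real.sq_sqrt (by positivity), one_div, inv_mul_eq_div, le_div_iff₀ hμ]
    linarith
  have hFc : UniformContinuous F := T.uniformContinuous.comp uniformContinuous_subtype_val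
  have : CompleteSpace (complSet n) := (isClosed_complSet n).completeSpace_coe
  have h := hF.isClosed_range hFc
  have e : Set.range F = Matrix.toEuclideanLin (lcpMatrix M) '' complSet n := by
    rw [Set.image_eq_range]; rfl
  rwa [e] at h

/-- The linear complementarity problem of a P-matrix is solvable: a minimiser of `‖Aw - b‖` over
`S₂` exists because `A` maps `S₂` onto a closed set, and it is stationary. -/
theorem IsPMatrix.exists_mem_inter {n : ℕ} {M : Matrix (Fin n) (Fin n) ℝ}
    (hM : IsPMatrix M) (b : Fin n → ℝ) :
    ∃ a ∈ complSet n, lcpMatrix M *ᵥ a.ofLp = b := by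
  let T : Space n →L[ℝ] EuclideanSpace ℝ (Fin n) :=
    (Matrix.toEuclideanLin (lcpMatrix M)).toContinuousLinearMap
  let B : EuclideanSpace ℝ (Fin n) := WithLp.toLp 2 b
  obtain ⟨_, ⟨a, ha, rfl⟩, hmin⟩ := (isClosed_image_complSet hM).exists_infDist_eq_dist
    ⟨_, 0, zero_mem_complSet n, rfl⟩ B
  refine ⟨a, ha, ?_⟩
  let u : EuclideanSpace ℝ (Fin n) := T a - B
  have hle : ∀ z ∈ complSet n, ‖u‖ ^ 2 ≤ ‖T z - B‖ ^ 2 := by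
    intro z hz
    refine pow_le_pow_left₀ (norm_nonneg _) ?_ 2
    have h1 : Metric.infDist B (Matrix.toEuclideanLin (lcpMatrix M) '' complSet n) ≤
        dist B (T z) := Metric.infDist_le_dist_of_mem ⟨z, hz, rfl⟩
    rw [hmin, dist_comm, dist_comm B, dist_eq_norm, dist_eq_norm] at h1
    exact h1
  have hu : u.ofLp = 0 := by
    refine hM.eq_zero_of_stationary (g := WithLp.toLp 2 ((lcpMatrix M)ᵀ *ᵥ u.ofLp)) rfl ha
      (C := ‖T‖ ^ 2) fun z hz => ?_
    have h1 := hle z hz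
    have h2 : T z - B = u + T (z - a) := by
      rw [map_sub]; simp only [u]; abel
    rw [h2, norm_add_sq_real] at h1
    have h3 : inner ℝ u (T (z - a)) =
        inner ℝ (WithLp.toLp 2 ((lcpMatrix M)ᵀ *ᵥ u.ofLp) : Space n) (z - a) := by
      rw [inner_eq_dotProduct, Matrix.mulVec_transpose, ← Matrix.dotProduct_mulVec,
        EuclideanSpace.inner_eq_star_dotProduct, dotProduct_comm]
      rfl
    have h4 : ‖T (z - a)‖ ^ 2 ≤ ‖T‖ ^ 2 * ‖z - a‖ ^ 2 := by
      rw [← mul_pow]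
      exact pow_le_pow_left₀ (norm_nonneg _) (T.le_opNorm _) 2
    rw [h3] at h1
    linarith
  exact sub_eq_zero.mp hu

end LCPProj

/-! ### Uniqueness and the linear complementarity problem -/

namespace LCPProj

theorem IsPMatrix.inter_eq_singleton {n : ℕ} {M : Matrix (Fin n) (Fin n) ℝ} (hM : IsPMatrix M)
    {b : Fin n → ℝ} {a : Space n} (ha : a ∈ complSet n) (hab : lcpMatrix M *ᵥ a.ofLp = b) :
    affineSet (lcpMatrix M) b ∩ complSet n = {a} := by
  refine Set.eq_singleton_iff_unique_mem.mpr ⟨⟨hab, ha⟩, fun w ⟨hw, hwc⟩ => ?_⟩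
  refine sub_eq_zero.mp (hM.eq_zero_of_lcpMatrix_mulVec_eq_zero
    (complSet_sub_mul_nonpos hwc ha) ?_)
  have hw' : lcpMatrix M *ᵥ w.ofLp = b := hw
  rw [WithLp.ofLp_sub, Matrix.mulVec_sub, hw', hab, sub_self]

/-- The solutions `x` of the linear complementarity problem correspond to the points
`(x, Mx - b)` of `S₁ ∩ S₂`. -/
theorem setOf_isLCPSolution_eq {n : ℕ} {M : Matrix (Fin n) (Fin n) ℝ} {b : Fin n → ℝ}
    {a : Space n} (h : affineSet (lcpMatrix M) b ∩ complSet n = {a}) :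
    {x : Fin n → ℝ | IsLCPSolution M b x} = {fun j => a (Sum.inl j)} := by
  have ha : a ∈ affineSet (lcpMatrix M) b ∩ complSet n := h ▸ Set.mem_singleton a
  ext x
  simp only [Set.mem_ofPred_eq, Set.mem_singleton_iff]
  constructor
  · rintro ⟨hx, hy, hxy⟩
    have hz : ∀ j, x j * (M *ᵥ x - b) j = 0 := fun j =>
      (Finset.sum_eq_zero_iff_of_nonneg fun j _ => mul_nonneg (hx j) (hy j)).mp hxy j
        (Finset.mem_univ j)
    have hw : (WithLp.toLp 2 (Sum.elim x (M *ᵥ x - b)) : Space n) ∈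
        affineSet (lcpMatrix M) b ∩ complSet n := by
      refine ⟨?_, fun j => ⟨hx j, hy j, hz j⟩⟩
      funext j
      rw [lcpMatrix_mulVec_apply]
      simp
    rw [h] at hw
    funext j
    rw [← Set.mem_singleton_iff.mp hw]
    rfl
  · rintro rfl
    have hy : M *ᵥ (fun j => a (Sum.inl j)) - b = fun j => a (Sum.inr j) := by
      have hab : lcpMatrix M *ᵥ a.ofLp = b := ha.1
      funext j
      rw [← hab, Pi.sub_apply, lcpMatrix_mulVec_apply]
      ring
    rw [IsLCPSolution, hy]
    exact ⟨fun j => (ha.2 j).1, fun j => (ha.2 j).2.1,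
      Finset.sum_eq_zero fun j _ => (ha.2 j).2.2⟩

/-! ### Step sizes -/

/-- For `Q = (AAᵀ)⁻¹` the Hessian `AᵀQA` is the orthogonal projection onto the row space of `A`. -/
theorem norm_hessian_inv_sq_eq {n : ℕ} (M : Matrix (Fin n) (Fin n) ℝ)
    (x : Space n) :
    ‖hessian (lcpMatrix M) (lcpMatrix M * (lcpMatrix M)ᵀ)⁻¹ x‖ ^ 2 =
      inner ℝ (hessian (lcpMatrix M) (lcpMatrix M * (lcpMatrix M)ᵀ)⁻¹ x) x := by
  have hu : IsUnit (lcpMatrix M * (lcpMatrix M)ᵀ).det :=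
    (Matrix.isUnit_iff_isUnit_det _).mp (posDef_lcpMatrix_mul_transpose M).isUnit
  rw [← real_inner_self_eq_norm_sq, inner_hessian, inner_hessian, ofLp_hessian]
  congr 1
  rw [Matrix.mulVec_mulVec, Matrix.mulVec_mulVec, Matrix.mul_nonsing_inv _ hu, Matrix.one_mulVec]

open scoped Matrix.Norms.L2Operator in
theorem norm_hessian_one_sq_le {n : ℕ} (A : Matrix (Fin n) (Fin n ⊕ Fin n) ℝ) (x : Space n) :
    ‖hessian A 1 x‖ ^ 2 ≤ ‖A‖ ^ 2 * inner ℝ (hessian A 1 x) x := by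
  let y : EuclideanSpace ℝ (Fin n) := WithLp.toLp 2 (A *ᵥ x.ofLp)
  have h1 : inner ℝ (hessian A 1 x) x = ‖y‖ ^ 2 := by
    rw [inner_hessian, Matrix.one_mulVec, EuclideanSpace.real_norm_sq_eq]
    simp [dotProduct, sq, y]
  have h2 : ‖hessian A 1 x‖ ≤ ‖A‖ * ‖y‖ := by
    have h3 := Matrix.l2_opNorm_mulVec Aᵀ y
    rw [← Matrix.conjTranspose_eq_transpose_of_trivial, Matrix.l2_opNorm_conjTranspose,
      Matrix.conjTranspose_eq_transpose_of_trivial] at h3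
    convert h3 using 2
    ext i
    rw [ofLp_hessian, Matrix.one_mulVec]
    rfl
  rw [h1, ← mul_pow]
  exact pow_le_pow_left₀ (norm_nonneg _) h2 2

/-- For admissible step sizes `lam (AᵀQA)² ≤ AᵀQA` as quadratic forms. This includes the case where
both `Q` and `(AAᵀ)⁻¹` are the identity, in which `L_Q = 1`. -/
theorem mul_norm_hessian_sq_le {n : ℕ} {M Q : Matrix (Fin n) (Fin n) ℝ}
    (hQ : Q = (lcpMatrix M * (lcpMatrix M)ᵀ)⁻¹ ∨ Q = 1) {lam : ℝ} (hlam : 0 < lam)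
    (hle : lam ≤ 1 / LQ (lcpMatrix M) Q) (x : Space n) :
    lam * ‖hessian (lcpMatrix M) Q x‖ ^ 2 ≤ inner ℝ (hessian (lcpMatrix M) Q x) x := by
  have hL : 0 < LQ (lcpMatrix M) Q := one_div_pos.mp (hlam.trans_le hle)
  rw [le_div_iff₀ hL] at hle
  by_cases h : Q = (lcpMatrix M * (lcpMatrix M)ᵀ)⁻¹
  · rw [LQ, if_pos h, mul_one] at hle
    have h1 := norm_hessian_inv_sq_eq M x
    rw [← h] at h1
    rw [← h1]
    exact mul_le_of_le_one_left (sq_nonneg _) hle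
  · rw [LQ, if_neg h] at hle
    obtain rfl := hQ.resolve_left h
    have h1 := mul_le_mul_of_nonneg_left (norm_hessian_one_sq_le (lcpMatrix M) x) hlam.le
    rw [← mul_assoc] at h1
    refine h1.trans (mul_le_of_le_one_left ?_ hle)
    rw [inner_hessian, Matrix.one_mulVec]
    exact Finset.sum_nonneg fun i _ => mul_self_nonneg _

/-! ### Alternating projections -/

/-- The projection onto `S₁` is the gradient step of length `1` for `Q = (AAᵀ)⁻¹`. -/
theorem proj_affineSet_eq {n : ℕ} {M : Matrix (Fin n) (Fin n) ℝ} {b : Fin n → ℝ} {a : Space n}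
    (hab : lcpMatrix M *ᵥ a.ofLp = b) (w : Space n) :
    proj (affineSet (lcpMatrix M) b) w =
      {w - hessian (lcpMatrix M) (lcpMatrix M * (lcpMatrix M)ᵀ)⁻¹ (w - a)} := by
  have hu : IsUnit (lcpMatrix M * (lcpMatrix M)ᵀ).det :=
    (Matrix.isUnit_iff_isUnit_det _).mp (posDef_lcpMatrix_mul_transpose M).isUnit
  set h := hessian (lcpMatrix M) (lcpMatrix M * (lcpMatrix M)ᵀ)⁻¹ (w - a) with hh
  have hAh : lcpMatrix M *ᵥ h.ofLp = lcpMatrix M *ᵥ (w - a).ofLp := by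
    rw [hh, ofLp_hessian, Matrix.mulVec_mulVec, Matrix.mulVec_mulVec,
      Matrix.mul_nonsing_inv _ hu, Matrix.one_mulVec]
  have hmem : w - h ∈ affineSet (lcpMatrix M) b := by
    change lcpMatrix M *ᵥ (w - h).ofLp = b
    rw [WithLp.ofLp_sub, Matrix.mulVec_sub, hAh, WithLp.ofLp_sub, Matrix.mulVec_sub, hab]
    abel
  have hpyth : ∀ z ∈ affineSet (lcpMatrix M) b,
      ‖z - w‖ ^ 2 = ‖z - (w - h)‖ ^ 2 + ‖h‖ ^ 2 := by
    intro z hz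
    have e : z - w = (z - (w - h)) - h := by abel
    have horth : inner ℝ (z - (w - h)) h = 0 := by
      have h1 : lcpMatrix M *ᵥ z.ofLp = b := hz
      have h2 : lcpMatrix M *ᵥ (w - h).ofLp = b := hmem
      have h3 : lcpMatrix M *ᵥ (z - (w - h)).ofLp = 0 := by
        rw [WithLp.ofLp_sub, Matrix.mulVec_sub, h1, h2, sub_self]
      rw [real_inner_comm, hh, inner_hessian, ← hh, h3, dotProduct_zero]
    rw [e, norm_sub_sq_real, horth]
    ring
  have hself : ‖w - h - w‖ = ‖h‖ := by rw [sub_sub_cancel_left, norm_neg]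
  refine Set.eq_singleton_iff_unique_mem.mpr ⟨⟨hmem, fun z hz => ?_⟩, fun z hz => ?_⟩
  · rw [hself]
    refine le_of_sq_le_sq ?_ (norm_nonneg _)
    linarith [hpyth z hz, sq_nonneg ‖z - (w - h)‖]
  · have h1 := pow_le_pow_left₀ (norm_nonneg _) (hz.2 _ hmem) 2
    rw [hself, hpyth z hz.1] at h1
    have h2 : ‖z - (w - h)‖ ^ 2 = 0 := le_antisymm (by linarith) (sq_nonneg _)
    exact sub_eq_zero.mp (norm_eq_zero.mp (pow_eq_zero_iff two_ne_zero |>.mp h2))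

/-! ### Convergence of the projected gradient method -/

theorem objective_of_mem {n : ℕ} (A : Matrix (Fin n) (Fin n ⊕ Fin n) ℝ)
    (Q : Matrix (Fin n) (Fin n) ℝ) (b : Fin n → ℝ) {w : Space n} (hw : w ∈ complSet n) :
    objective A Q b w = (fQ A Q b w : EReal) := by
  rw [objective, if_pos hw, add_zero]

theorem objective_nonneg {n : ℕ} {A : Matrix (Fin n) (Fin n ⊕ Fin n) ℝ}
    {Q : Matrix (Fin n) (Fin n) ℝ} {b : Fin n → ℝ} {w : Space n} (hw : 0 ≤ fQ A Q b w) :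
    0 ≤ objective A Q b w := by
  have h : (0 : EReal) ≤ (fQ A Q b w : EReal) := EReal.coe_nonneg.mpr hw
  rw [objective]
  refine add_nonneg h ?_
  split_ifs
  exacts [le_rfl, le_top]

/-- Convergence and local rates, with the constants `κ = √(1 - lam μ)` and `c = 1 / (1 + lam μ)`,
where `μ` is the constant of the error bound on `S₂`. -/
theorem IsPMatrix.psMap_rates {n : ℕ} {M : Matrix (Fin n) (Fin n) ℝ}
    (hM : IsPMatrix M) {b : Fin n → ℝ} {a : Space n} (ha : a ∈ complSet n)
    (hab : lcpMatrix M *ᵥ a.ofLp = b) {Q : Matrix (Fin n) (Fin n) ℝ} (hQ : Q.PosDef) {lam : ℝ}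
    (hlam : 0 < lam)
    (hHlam : ∀ x, lam * ‖hessian (lcpMatrix M) Q x‖ ^ 2 ≤
      inner ℝ (hessian (lcpMatrix M) Q x) x) :
    ∃ κ c : ℝ, 0 ≤ κ ∧ κ < 1 ∧ 0 ≤ c ∧ c < 1 ∧
      ∀ w : ℕ → Space n, (∀ k, w (k + 1) ∈ psMap (lcpMatrix M) Q b lam (w k)) →
        Tendsto w atTop (𝓝 a) ∧
        (∀ᶠ k in atTop, ‖w (k + 1) - a‖ ≤ κ * ‖w k - a‖) ∧
        Tendsto (fun k => objective (lcpMatrix M) Q b (w k)) atTop (𝓝 0) ∧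
        (∀ᶠ k in atTop, objective (lcpMatrix M) Q b (w (k + 1)) ≤
          (c : EReal) * objective (lcpMatrix M) Q b (w k)) := by
  obtain ⟨μ, hμ0, hμ⟩ := hM.exists_le_inner_hessian hQ
  have hH := inner_hessian_comm (lcpMatrix M) hQ
  have hm : 0 < lam * μ := mul_pos hlam hμ0
  refine ⟨Real.sqrt (1 - lam * μ), 1 / (1 + lam * μ), Real.sqrt_nonneg _, ?_, by positivity,
    (div_lt_one (by positivity)).mpr (by linarith), fun w hw => ?_⟩
  · rw [Real.sqrt_lt' one_pos]
    linarith
  replace hw : ∀ k, w (k + 1) ∈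
      proj (complSet n) (w k - lam • hessian (lcpMatrix M) Q (w k - a)) := by
    intro k
    rw [← gradient_fQ hQ hab]
    exact hw k
  have hfix : ∀ w ∈ complSet n, (∀ z ∈ complSet n,
      0 ≤ 2 * inner ℝ (hessian (lcpMatrix M) Q (w - a)) (z - w) + (1 / lam) * ‖z - w‖ ^ 2) →
      w = a := by
    intro w hw h
    have h1 := hM.eq_zero_of_stationary (ofLp_hessian _ _ _) hw h
    exact sub_eq_zero.mp (hM.eq_zero_of_lcpMatrix_mulVec_eq_zero (complSet_sub_mul_nonpos hw ha)
      (eq_zero_of_posDef_mulVec_eq_zero hQ h1))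
  have hlim : Tendsto w atTop (𝓝 a) := tendsto_of_mem_proj_step hH hlam hμ0 hHlam
    (isClosed_complSet n) (fun w hw => hμ w hw a ha) hfix hw
  have hlim' : Tendsto (fun k => w (k + 1)) atTop (𝓝 a) := hlim.comp (tendsto_add_atTop_nat 1)
  -- membership in `S₂` holds from the first iterate on; `w 0` is arbitrary
  have hmem : ∀ᶠ k in atTop, w k ∈ complSet n := by
    filter_upwards [eventually_ge_atTop 1] with k hk
    obtain ⟨j, rfl⟩ := Nat.exists_eq_add_of_le' hk
    exact (hw j).1
  have hseg := eventually_segment_mem_complSet ha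
  have hfc : Continuous (fQ (lcpMatrix M) Q b) := by
    rw [funext (fQ_eq_inner_hessian hQ hab)]
    fun_prop
  have hfa : fQ (lcpMatrix M) Q b a = 0 := by
    rw [fQ_eq_inner_hessian hQ hab]
    simp
  refine ⟨hlim, ?_, ?_, ?_⟩
  · filter_upwards [hmem, hlim'.eventually hseg] with k hk hk'
    have h1 := norm_sq_step_le hlam hHlam (hμ _ hk a ha) (hw k) (hk' (hw k).1)
    refine le_of_sq_le_sq ?_ (by positivity)
    rw [mul_pow, Real.sq_sqrt']
    exact h1.trans (mul_le_mul_of_nonneg_right (le_max_left _ _) (sq_nonneg _))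
  · have h1 : Tendsto (fun k => ((fQ (lcpMatrix M) Q b (w k) : ℝ) : EReal)) atTop (𝓝 0) := by
      have h2 := (hfc.tendsto a).comp hlim
      rw [hfa] at h2
      exact (continuous_coe_real_ereal.tendsto 0).comp h2
    refine h1.congr' ?_
    filter_upwards [hmem] with k hk
    rw [objective_of_mem _ _ _ hk]
  · filter_upwards [hmem, hlim.eventually hseg] with k hk hk'
    have h1 := inner_map_step_le_mul hH hlam hμ0 hHlam (hμ _ hk a ha) (hw k) (hk' hk)
    rw [objective_of_mem _ _ _ hk, objective_of_mem _ _ _ (hw k).1, ← EReal.coe_mul,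
      EReal.coe_le_coe_iff, fQ_eq_inner_hessian hQ hab, fQ_eq_inner_hessian hQ hab]
    linarith

end LCPProj

theorem mainTheorem11 (n : ℕ) (M : Matrix (Fin n) (Fin n) ℝ) (hM : LCPProj.IsPMatrix M)
    (b : Fin n → ℝ) :
    -- unique point of `S₁ ∩ S₂`, and its correspondence to the unique solution of the LCP
    (∃ wstar : LCPProj.Space n,
      LCPProj.affineSet (LCPProj.lcpMatrix M) b ∩ LCPProj.complSet n = {wstar} ∧
      {x : Fin n → ℝ | LCPProj.IsLCPSolution M b x} = {fun j => wstar (Sum.inl j)} ∧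
      ∀ Q : Matrix (Fin n) (Fin n) ℝ,
        Q = (LCPProj.lcpMatrix M * (LCPProj.lcpMatrix M)ᵀ)⁻¹ ∨ Q = 1 →
        -- the global optimal value is `0`, attained at `wstar`
        (LCPProj.objective (LCPProj.lcpMatrix M) Q b wstar = 0 ∧
          ∀ w : LCPProj.Space n, 0 ≤ LCPProj.objective (LCPProj.lcpMatrix M) Q b w) ∧
        ∀ lam : ℝ, 0 < lam → lam ≤ 1 / LCPProj.LQ (LCPProj.lcpMatrix M) Q →
          ∃ κ c : ℝ, 0 ≤ κ ∧ κ < 1 ∧ 0 ≤ c ∧ c < 1 ∧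
            ∀ w : ℕ → LCPProj.Space n,
              (∀ k, w (k + 1) ∈ LCPProj.psMap (LCPProj.lcpMatrix M) Q b lam (w k)) →
              -- convergence of the iterates with a local Q-linear rate
              Tendsto w atTop (𝓝 wstar) ∧
              (∀ᶠ k in atTop, ‖w (k + 1) - wstar‖ ≤ κ * ‖w k - wstar‖) ∧
              -- convergence of the objective values with a local Q-linear rate
              Tendsto (fun k => LCPProj.objective (LCPProj.lcpMatrix M) Q b (w k))
                atTop (𝓝 0) ∧
              (∀ᶠ k in atTop, LCPProj.objective (LCPProj.lcpMatrix M) Q b (w (k + 1)) ≤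
                (c : EReal) * LCPProj.objective (LCPProj.lcpMatrix M) Q b (w k))) ∧
    -- for `Q = (AAᵀ)⁻¹` the largest step size is `1` and gives alternating projections
    (LCPProj.LQ (LCPProj.lcpMatrix M)
        (LCPProj.lcpMatrix M * (LCPProj.lcpMatrix M)ᵀ)⁻¹ = 1 ∧
      ∀ w : LCPProj.Space n,
        LCPProj.psMap (LCPProj.lcpMatrix M)
            (LCPProj.lcpMatrix M * (LCPProj.lcpMatrix M)ᵀ)⁻¹ b 1 w =
          LCPProj.altProj (LCPProj.affineSet (LCPProj.lcpMatrix M) b)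
            (LCPProj.complSet n) w) := by
  obtain ⟨a, ha, hab⟩ := hM.exists_mem_inter b
  have hinter := hM.inter_eq_singleton ha hab
  have hinv := (LCPProj.posDef_lcpMatrix_mul_transpose M).inv
  refine ⟨⟨a, hinter, LCPProj.setOf_isLCPSolution_eq hinter, fun Q hQ => ?_⟩, ?_, fun w => ?_⟩
  · have hQpos : Q.PosDef := by
      rcases hQ with rfl | rfl
      exacts [hinv, Matrix.PosDef.one]
    refine ⟨⟨?_, fun w => LCPProj.objective_nonneg ?_⟩, fun lam hlam hle =>
      hM.psMap_rates ha hab hQpos hlam (LCPProj.mul_norm_hessian_sq_le hQ hlam hle)⟩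
    · rw [LCPProj.objective_of_mem _ _ _ ha, LCPProj.fQ_eq_inner_hessian hQpos hab]
      simp
    · rw [LCPProj.fQ_eq_inner_hessian hQpos hab, LCPProj.inner_hessian,
        LCPProj.mulVec_dotProduct_comm hQpos]
      have h := hQpos.posSemidef.dotProduct_mulVec_nonneg
        (LCPProj.lcpMatrix M *ᵥ (w - a).ofLp)
      rw [star_trivial] at h
      positivity
  · rw [LCPProj.LQ, if_pos rfl]
  · ext y
    rw [LCPProj.psMap, LCPProj.altProj, LCPProj.gradient_fQ hinv hab,
      LCPProj.proj_affineSet_eq hab, one_smul]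
    simp
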